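/- Let $X$ be a locally compact Hausdorff space and $G$ a discrete group. Let $\theta$ be a partial action of $G$ on $X$: open sets $U_t\subseteq X$ and homeomorphisms $\theta_t:U_{t^{-1}}\to U_t$ $(t\in G)$ such that $\theta_e=\mathrm{id}_X$ and $\theta_{st}$ extends $\theta_s\theta_t$ for all $s,t\in G$. Let $\alpha$ be the corresponding partial action on $C_0(X)$, with ideals $D_t=C_0(U_t)$ and $\alpha_t(f)(x)=f(\theta_{t^{-1}}(x))$ for $f\in D_{t^{-1}}$, $x\in U_t$. Suppose that $\theta$ is topologically free: for every $t\ne e$ the set $\{x\in U_{t^{-1}}:\theta_t(x)=x\}$ has empty interior. Let $C_0(X)\rtimes_r G$ be the reduced crossed product. It is realised as follows: for any faithful representation $\pi$ of $C_0(X)$ on a Hilbert space $H$, it is the $C^*$-algebra of operators on $\ell^2(G,H)$ generated by the operators $a\delta_t$ ($t\in G$, $a\in D_t$), $(a\delta_t\,\xi)(r)=\pi_r(a)\,\xi(t^{-1}r)$, where $\pi_r(a)$ is the operator on $H$ with $\pi_r(a)\pi(b)h=\pi\bigl(\alpha_{r^{-1}}(a\,\alpha_r(b))\bigr)h$ for $b\in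 D_{r^{-1}}$, $h\in H$, and $\pi_r(a)=0$ on $(\pi(D_{r^{-1}})H)^\perp$. Regard $C_0(X)$ as a subalgebra through $f\mapsto f\delta_e$. Then: 1. If $I$ is a closed two-sided ideal of $C_0(X)\rtimes_r G$ with $I\cap C_0(X)=\{0\}$, then $I=\{0\}$. 2. A representation ($*$-homomorphism into the bounded operators on a Hilbert space) of $C_0(X)\rtimes_r G$ is faithful if and only if its restriction to $C_0(X)$ is faithful. -/

import Mathlib

open Set Topology
open scoped ZeroAtInfty InnerProductSpace

noncomputable section

/-- A partial action of a (discrete) group `G` on a topological space `X` by partial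
homeomorphisms: open sets `U t` and homeomorphisms `θ t : U t⁻¹ → U t` such that `θ 1` is the
identity of `X` and `θ (s * t)` extends `θ s ∘ θ t`. The values of `map t` outside of its source
`U t⁻¹` carry no meaning. -/
structure PartialAction (G X : Type*) [Group G] [TopologicalSpace X] where
  /-- The partial homeomorphism `θ t`. -/
  map : G → OpenPartialHomeomorph X X
  source_eq : ∀ t, (map t).source = (map t⁻¹).target
  map_one_source : (map 1).source = univ
  map_one_apply : ∀ x, map 1 x = x
  map_comp : ∀ s t x, x ∈ (map t).source → map t x ∈ (map s).source →
    x ∈ (map (s * t)).source ∧ map (s * t) x = map s (map t x)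

namespace PartialAction

variable {G X : Type*} [Group G] [TopologicalSpace X] (θ : PartialAction G X)

/-- The open set `U t`, the range of `θ t`. The domain of `θ t` is `U t⁻¹`. -/
def U (t : G) : Set X := (θ.map t).target

/-- The fixed point set `F t = {x ∈ U t⁻¹ : θ t x = x}`. -/
def fixedPts (t : G) : Set X := {x | x ∈ θ.U t⁻¹ ∧ θ.map t x = x}

/-- Topological freeness: `F t` has empty interior for every `t ≠ 1`. -/
def TopologicallyFree : Prop := ∀ t : G, t ≠ 1 → interior (θ.fixedPts t) = ∅

/-- The ideal `D t = C₀(U t)` of `C₀(X)`. -/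
def D (t : G) : Set C₀(X, ℂ) := {f | ∀ x, x ∉ θ.U t → f x = 0}

theorem isOpen_U (t : G) : IsOpen (θ.U t) := (θ.map t).open_target

theorem continuousOn_map (t : G) : ContinuousOn (θ.map t) (θ.U t⁻¹) := by
  have := (θ.map t).continuousOn
  rwa [θ.source_eq] at this

/-- If `c` is bounded on the open set `U` and continuous there, and `b` is in `C₀(U)`, then the
product `c b` is again in `C₀(U)`. -/
def mulOn {U : Set X} (hU : IsOpen U) (c : X → ℂ) (hc : ContinuousOn c U) (K : ℝ)
    (hK : ∀ x ∈ U, ‖c x‖ ≤ K) (b : C₀(X, ℂ)) (hb : ∀ x, x ∉ U → b x = 0) : C₀(X, ℂ) where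
  toFun x := c x * b x
  continuous_toFun := by
    have hle : ∀ x, ‖c x * b x‖ ≤ K * ‖b x‖ := fun x => by
      by_cases hx : x ∈ U
      · rw [norm_mul]; exact mul_le_mul_of_nonneg_right (hK x hx) (norm_nonneg _)
      · simp [hb x hx]
    rw [continuous_iff_continuousAt]
    intro x
    by_cases hx : x ∈ U
    · exact (hc.continuousAt (hU.mem_nhds hx)).mul (map_continuous b).continuousAt
    · have h0 : Filter.Tendsto (fun y => K * ‖b y‖) (𝓝 x) (𝓝 0) := by
        have : Filter.Tendsto (fun y => K * ‖b y‖) (𝓝 x) (𝓝 (K * ‖b x‖)) :=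
          ((map_continuous b).norm.const_mul K).continuousAt
        simpa [hb x hx] using this
      have : Filter.Tendsto (fun y => c y * b y) (𝓝 x) (𝓝 0) :=
        squeeze_zero_norm hle h0
      simpa [ContinuousAt, hb x hx] using this
  zero_at_infty' := by
    have hle : ∀ x, ‖c x * b x‖ ≤ K * ‖b x‖ := fun x => by
      by_cases hx : x ∈ U
      · rw [norm_mul]; exact mul_le_mul_of_nonneg_right (hK x hx) (norm_nonneg _)
      · simp [hb x hx]
    have h0 : Filter.Tendsto (fun y => K * ‖b y‖) (Filter.cocompact X) (𝓝 0) := by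
      simpa using (b.zero_at_infty'.norm).const_mul K
    exact squeeze_zero_norm hle h0

theorem norm_apply_le (f : C₀(X, ℂ)) (x : X) : ‖f x‖ ≤ ‖f‖ := by
  rw [← ZeroAtInftyContinuousMap.norm_toBCF_eq_norm]
  exact f.toBCF.norm_coe_le_norm x

/-- For `b` in `D t⁻¹`, the function `x ↦ f (θ t x) * b x` on `U t⁻¹`, extended by `0`. In terms of
the partial action `α` on `C₀(X)` given by `α t g = g ∘ θ t⁻¹` for `g` in `D t⁻¹`, this is the
element `α t⁻¹ (f * α t b)` of `D t⁻¹`. -/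
def pullMul (t : G) (f : C₀(X, ℂ)) (b : θ.D t⁻¹) : C₀(X, ℂ) :=
  mulOn (θ.isOpen_U t⁻¹) (fun x => f (θ.map t x))
    ((map_continuous f).comp_continuousOn (θ.continuousOn_map t)) ‖f‖
    (fun _ _ => norm_apply_le f _) b.1 b.2

@[simp]
theorem pullMul_apply (t : G) (f : C₀(X, ℂ)) (b : θ.D t⁻¹) (x : X) :
    θ.pullMul t f b x = f (θ.map t x) * b.1 x := rfl

variable {H : Type*} [NormedAddCommGroup H] [InnerProductSpace ℂ H] [CompleteSpace H]
  (π : C₀(X, ℂ) →⋆ₙₐ[ℂ] (H →L[ℂ] H))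

/-- The closed linear span of `π(D t⁻¹) H`. -/
def essSpace (t : G) : Submodule ℂ H :=
  (Submodule.span ℂ {v | ∃ (b : θ.D t⁻¹) (h : H), v = π b.1 h}).topologicalClosure

theorem inner_apply_apply (b c : C₀(X, ℂ)) (h k : H) :
    ⟪π b h, π c k⟫_ℂ = ⟪h, π (star b * c) k⟫_ℂ := by
  rw [map_mul, map_star, ContinuousLinearMap.star_eq_adjoint, mul_apply_eq_comp,
    ContinuousLinearMap.adjoint_inner_right]

/-- The linear map sending the formal sum of the pairs `(b, h)` to `∑ π (L b) h`. -/
def sumMap {ι : Type*} (L : ι → C₀(X, ℂ)) : (ι →₀ H) →ₗ[ℂ] H :=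
  Finsupp.lsum ℂ fun i => (π (L i)).toLinearMap

theorem sumMap_apply {ι : Type*} (L : ι → C₀(X, ℂ)) (z : ι →₀ H) :
    sumMap π L z = ∑ i ∈ z.support, π (L i) (z i) := by
  simp [sumMap, Finsupp.sum]

theorem inner_sumMap {ι : Type*} (L : ι → C₀(X, ℂ)) (z : ι →₀ H) :
    ⟪sumMap π L z, sumMap π L z⟫_ℂ =
      ∑ i ∈ z.support, ∑ j ∈ z.support, ⟪z i, π (star (L i) * L j) (z j)⟫_ℂ := by
  rw [sumMap_apply, sum_inner]
  refine Finset.sum_congr rfl fun i _ => ?_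
  rw [inner_sum]
  exact Finset.sum_congr rfl fun j _ => inner_apply_apply π _ _ _ _

theorem norm_sumMap_le (t : G) (f : C₀(X, ℂ)) (z : θ.D t⁻¹ →₀ H) :
    ‖sumMap π (θ.pullMul t f) z‖ ≤ ‖f‖ * ‖sumMap π (fun b : θ.D t⁻¹ => b.1) z‖ := by
  set d : X → ℂ := fun x => ((Real.sqrt (‖f‖ ^ 2 - ‖f (θ.map t x)‖ ^ 2) : ℝ) : ℂ) with hd
  have hsq : ∀ x, 0 ≤ ‖f‖ ^ 2 - ‖f (θ.map t x)‖ ^ 2 := fun x => by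
    have := norm_apply_le f (θ.map t x)
    have := norm_nonneg (f (θ.map t x))
    nlinarith
  have hdc : ContinuousOn d (θ.U t⁻¹) := by
    have : ContinuousOn (fun x => f (θ.map t x)) (θ.U t⁻¹) :=
      (map_continuous f).comp_continuousOn (θ.continuousOn_map t)
    exact Complex.continuous_ofReal.comp_continuousOn
      (Real.continuous_sqrt.comp_continuousOn (continuousOn_const.sub (this.norm.pow 2)))
  have hdK : ∀ x ∈ θ.U t⁻¹, ‖d x‖ ≤ ‖f‖ := fun x _ => by
    rw [hd, Complex.norm_real, Real.norm_of_nonneg (Real.sqrt_nonneg _)]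
    refine Real.sqrt_le_iff.2 ⟨norm_nonneg _, ?_⟩
    nlinarith [sq_nonneg ‖f (θ.map t x)‖]
  let L : θ.D t⁻¹ → C₀(X, ℂ) := fun b => mulOn (θ.isOpen_U t⁻¹) d hdc ‖f‖ hdK b.1 b.2
  have key : ∀ b c : θ.D t⁻¹, star (θ.pullMul t f b) * θ.pullMul t f c + star (L b) * L c =
      ((‖f‖ ^ 2 : ℝ) : ℂ) • (star b.1 * c.1) := by
    intro b c
    ext x
    have h1 : (starRingEnd ℂ) (f (θ.map t x)) * f (θ.map t x) =
        ((‖f (θ.map t x)‖ ^ 2 : ℝ) : ℂ) := by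
      rw [mul_comm, Complex.mul_conj, Complex.normSq_eq_norm_sq]
    have h2 : (starRingEnd ℂ) (d x) * d x = ((‖f‖ ^ 2 - ‖f (θ.map t x)‖ ^ 2 : ℝ) : ℂ) := by
      rw [hd, Complex.conj_ofReal, ← Complex.ofReal_mul, Real.mul_self_sqrt (hsq x)]
    have hL : ∀ e : θ.D t⁻¹, L e x = d x * e.1 x := fun _ => rfl
    simp only [ZeroAtInftyContinuousMap.add_apply, ZeroAtInftyContinuousMap.mul_apply,
      ZeroAtInftyContinuousMap.star_apply, ZeroAtInftyContinuousMap.smul_apply, pullMul_apply, hL,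
      smul_eq_mul, star_mul', RCLike.star_def]
    calc _ = ((starRingEnd ℂ) (f (θ.map t x)) * f (θ.map t x) + (starRingEnd ℂ) (d x) * d x) *
          ((starRingEnd ℂ) (b.1 x) * c.1 x) := by ring
      _ = _ := by rw [h1, h2, ← Complex.ofReal_add]; congr 2; ring
  have hin : ⟪sumMap π (θ.pullMul t f) z, sumMap π (θ.pullMul t f) z⟫_ℂ +
      ⟪sumMap π L z, sumMap π L z⟫_ℂ = ((‖f‖ ^ 2 : ℝ) : ℂ) *
      ⟪sumMap π (fun b : θ.D t⁻¹ => b.1) z, sumMap π (fun b : θ.D t⁻¹ => b.1) z⟫_ℂ := by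
    simp only [inner_sumMap, ← Finset.sum_add_distrib, Finset.mul_sum]
    refine Finset.sum_congr rfl fun i _ => Finset.sum_congr rfl fun j _ => ?_
    rw [← inner_add_right, ← _root_.add_apply, ← map_add, key, map_smul,
      _root_.smul_apply, inner_smul_right]
  simp only [inner_self_eq_norm_sq_to_K] at hin
  have hre : ‖sumMap π (θ.pullMul t f) z‖ ^ 2 + ‖sumMap π L z‖ ^ 2 =
      ‖f‖ ^ 2 * ‖sumMap π (fun b : θ.D t⁻¹ => b.1) z‖ ^ 2 := by
    have := congrArg Complex.re hin
    simpa [← Complex.ofReal_pow, ← Complex.ofReal_mul, ← Complex.ofReal_add] using this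
  refine le_of_sq_le_sq ?_ (by positivity)
  nlinarith [sq_nonneg ‖sumMap π L z‖]

theorem mem_essSpace {t : G} (b : θ.D t⁻¹) (h : H) : π b.1 h ∈ θ.essSpace π t :=
  Submodule.le_topologicalClosure _ (Submodule.subset_span ⟨b, h, rfl⟩)

theorem pullMul_mem (t : G) (f : C₀(X, ℂ)) (b : θ.D t⁻¹) : θ.pullMul t f b ∈ θ.D t⁻¹ :=
  fun x hx => by rw [pullMul_apply, b.2 x hx, mul_zero]

instance (t : G) : CompleteSpace (θ.essSpace π t) :=
  (Submodule.isClosed_topologicalClosure _).completeSpace_coe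

theorem clm_ext {F : Type*} [NormedAddCommGroup F] [NormedSpace ℂ F] (t : G) {A B : H →L[ℂ] F}
    (h₁ : ∀ (b : θ.D t⁻¹) (h : H), A (π b.1 h) = B (π b.1 h))
    (h₂ : ∀ v ∈ (θ.essSpace π t)ᗮ, A v = B v) : A = B := by
  have hE : ∀ v ∈ θ.essSpace π t, A v = B v := by
    have hle : θ.essSpace π t ≤ LinearMap.ker (A - B).toLinearMap := by
      refine Submodule.topologicalClosure_minimal _ (Submodule.span_le.2 ?_) (A - B).isClosed_ker
      rintro _ ⟨b, h, rfl⟩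
      simp [h₁ b h]
    intro v hv
    have := hle hv
    simpa [sub_eq_zero] using this
  ext v
  obtain ⟨y, hy, z, hz, rfl⟩ := (θ.essSpace π t).exists_add_mem_mem_orthogonal v
  rw [map_add, map_add, hE y hy, h₂ z hz]

theorem exists_indRep (t : G) (f : C₀(X, ℂ)) :
    ∃ T : H →L[ℂ] H, ((∀ (b : θ.D t⁻¹) (h : H), T (π b.1 h) = π (θ.pullMul t f b) h) ∧
      (∀ v ∈ (θ.essSpace π t)ᗮ, T v = 0)) ∧ ‖T‖ ≤ ‖f‖ := by
  set Φ := sumMap π (fun b : θ.D t⁻¹ => b.1)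
  have hspan : LinearMap.range Φ =
      Submodule.span ℂ {v | ∃ (b : θ.D t⁻¹) (h : H), v = π b.1 h} := by
    apply le_antisymm
    · rintro _ ⟨z, rfl⟩
      rw [sumMap_apply]
      exact Submodule.sum_mem _ fun i _ => Submodule.subset_span ⟨i, z i, rfl⟩
    · refine Submodule.span_le.2 ?_
      rintro _ ⟨b, h, rfl⟩
      exact ⟨Finsupp.single b h, by simp [Φ, sumMap]⟩
  have hmem : ∀ z, Φ z ∈ θ.essSpace π t := fun z =>
    Submodule.le_topologicalClosure _ (hspan ▸ LinearMap.mem_range_self Φ z)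
  let e : (θ.D t⁻¹ →₀ H) →ₗ[ℂ] θ.essSpace π t := Φ.codRestrict _ hmem
  have hdense : DenseRange e := by
    intro v
    rw [closure_subtype]
    have : (Subtype.val '' Set.range e : Set H) = LinearMap.range Φ := by
      ext w
      simp [e]
    rw [this, hspan]
    exact v.2
  have hnorm : ∀ z, ‖sumMap π (θ.pullMul t f) z‖ ≤ ‖f‖ * ‖e z‖ := fun z =>
    θ.norm_sumMap_le π t f z
  refine ⟨((sumMap π (θ.pullMul t f)).extendOfNorm e).comp (θ.essSpace π t).orthogonalProjectionOnto,
    ⟨?_, ?_⟩, ?_⟩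
  · intro b h
    have h1 : (θ.essSpace π t).orthogonalProjectionOnto (π b.1 h) = e (Finsupp.single b h) := by
      have : (e (Finsupp.single b h) : H) = π b.1 h := by simp [e, Φ, sumMap]
      rw [← this, Submodule.orthogonalProjectionOnto_mem_subspace_eq_self]
    rw [ContinuousLinearMap.comp_apply, h1, LinearMap.extendOfNorm_eq hdense ⟨_, hnorm⟩]
    simp [sumMap]
  · intro v hv
    rw [ContinuousLinearMap.comp_apply,
      Submodule.orthogonalProjectionOnto_apply_of_mem_orthogonal hv, map_zero]
  · refine ContinuousLinearMap.opNorm_le_bound _ (norm_nonneg _) fun v => ?_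
    rw [ContinuousLinearMap.comp_apply]
    refine (LinearMap.norm_extendOfNorm_apply_le hdense _ hnorm _).trans ?_
    gcongr
    exact Submodule.norm_orthogonalProjectionOnto_apply_le _ _

/-- There is exactly one bounded operator that maps `π b h` to `π (α t⁻¹ (f * α t b)) h` for all
`b` in `D t⁻¹` and all `h`, and vanishes on the orthogonal complement of `π(D t⁻¹) H`. -/
theorem existsUnique_indRep (t : G) (f : C₀(X, ℂ)) :
    ∃! T : H →L[ℂ] H, (∀ (b : θ.D t⁻¹) (h : H), T (π b.1 h) = π (θ.pullMul t f b) h) ∧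
      (∀ v ∈ (θ.essSpace π t)ᗮ, T v = 0) := by
  obtain ⟨T, hT, -⟩ := θ.exists_indRep π t f
  refine ⟨T, hT, fun S hS => θ.clm_ext π t (fun b h => ?_) fun v hv => ?_⟩
  · rw [hS.1, hT.1]
  · rw [hS.2 v hv, hT.2 v hv]

/-- The operator `π_t(f)`, where `π_t` is the canonical extension of the representation
`π ∘ α t⁻¹` of `D t` to all of `C₀(X)`: it maps `π b h` to `π (α t⁻¹ (f * α t b)) h` for `b` in
`D t⁻¹`, and vanishes on the orthogonal complement of `π(D t⁻¹) H`. -/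
def indOp (t : G) (f : C₀(X, ℂ)) : H →L[ℂ] H := (θ.existsUnique_indRep π t f).choose

theorem indOp_apply (t : G) (f : C₀(X, ℂ)) (b : θ.D t⁻¹) (h : H) :
    θ.indOp π t f (π b.1 h) = π (θ.pullMul t f b) h :=
  (θ.existsUnique_indRep π t f).choose_spec.1.1 b h

theorem indOp_orthogonal (t : G) (f : C₀(X, ℂ)) {v : H} (hv : v ∈ (θ.essSpace π t)ᗮ) :
    θ.indOp π t f v = 0 :=
  (θ.existsUnique_indRep π t f).choose_spec.1.2 v hv

theorem norm_indOp_le (t : G) (f : C₀(X, ℂ)) : ‖θ.indOp π t f‖ ≤ ‖f‖ := by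
  obtain ⟨T, hT, hn⟩ := θ.exists_indRep π t f
  have : θ.indOp π t f = T :=
    (θ.existsUnique_indRep π t f).unique (θ.existsUnique_indRep π t f).choose_spec.1 hT
  rwa [this]

/-- The representation `π_t` of `C₀(X)` on `H`. -/
def indRep (t : G) : C₀(X, ℂ) →⋆ₙₐ[ℂ] (H →L[ℂ] H) where
  toFun := θ.indOp π t
  map_smul' c f := by
    refine θ.clm_ext π t (fun b h => ?_) fun v hv => ?_
    · have : θ.pullMul t (c • f) b = c • θ.pullMul t f b := by ext x; simp [mul_assoc]
      simp [indOp_apply, this]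
    · simp [indOp_orthogonal, hv]
  map_zero' := by
    refine θ.clm_ext π t (fun b h => ?_) fun v hv => ?_
    · have : θ.pullMul t 0 b = 0 := by ext x; simp
      simp [indOp_apply, this]
    · simp [indOp_orthogonal, hv]
  map_add' f g := by
    refine θ.clm_ext π t (fun b h => ?_) fun v hv => ?_
    · have : θ.pullMul t (f + g) b = θ.pullMul t f b + θ.pullMul t g b := by
        ext x; simp [add_mul]
      simp [indOp_apply, this]
    · simp [indOp_orthogonal, hv]
  map_mul' f g := by
    refine θ.clm_ext π t (fun b h => ?_) fun v hv => ?_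
    · have : θ.pullMul t (f * g) b = θ.pullMul t f ⟨θ.pullMul t g b, θ.pullMul_mem t g b⟩ := by
        ext x; simp [mul_assoc]
      rw [mul_apply_eq_comp, indOp_apply, indOp_apply, this, ← indOp_apply]
    · simp [indOp_orthogonal, hv]
  map_star' f := by
    rw [ContinuousLinearMap.star_eq_adjoint]
    have hran : ∀ w ∈ (θ.essSpace π t)ᗮ, ∀ v, ⟪w, θ.indOp π t f v⟫_ℂ = 0 := by
      intro w hw v
      have : (innerSL ℂ w).comp (θ.indOp π t f) = 0 := by
        refine θ.clm_ext π t (fun b h => ?_) fun v hv => ?_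
        · rw [ContinuousLinearMap.comp_apply, indOp_apply, innerSL_apply_apply]
          exact (Submodule.mem_orthogonal' _ w).1 hw _
            (θ.mem_essSpace π ⟨_, θ.pullMul_mem t f b⟩ h)
        · simp [indOp_orthogonal, hv]
      exact congrArg (fun A : H →L[ℂ] ℂ => A v) this
    refine θ.clm_ext π t (fun b h => ?_) fun w hw => ?_
    · refine ext_inner_right ℂ fun v => ?_
      rw [ContinuousLinearMap.adjoint_inner_left, indOp_apply]
      have : innerSL ℂ (π (θ.pullMul t (star f) b) h) =
          (innerSL ℂ (π b.1 h)).comp (θ.indOp π t f) := by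
        refine θ.clm_ext π t (fun b' h' => ?_) fun v hv => ?_
        · rw [ContinuousLinearMap.comp_apply, indOp_apply, innerSL_apply_apply,
            innerSL_apply_apply, inner_apply_apply, inner_apply_apply]
          congr 3
          ext x
          simp
          ring
        · rw [ContinuousLinearMap.comp_apply, θ.indOp_orthogonal π t f hv, map_zero,
            innerSL_apply_apply]
          exact (Submodule.mem_orthogonal _ v).1 hv _
            (θ.mem_essSpace π ⟨_, θ.pullMul_mem t (star f) b⟩ h)
      exact congrArg (fun A : H →L[ℂ] ℂ => A v) this
    · rw [θ.indOp_orthogonal π t _ hw]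
      refine ext_inner_right ℂ fun v => ?_
      rw [ContinuousLinearMap.adjoint_inner_left, hran w hw v, inner_zero_left]

end PartialAction

/-- The Hilbert space `ℓ²(G, H)`. -/
abbrev L2 (G H : Type*) [NormedAddCommGroup H] := lp (fun _ : G => H) 2

section Operators

variable {G H : Type*} [Group G] [NormedAddCommGroup H] [InnerProductSpace ℂ H]

/-- The operator `(T ξ)(t) = A t (ξ (σ t))` on `ℓ²(G, H)`, for a bounded family of operators `A t`
and a permutation `σ` of `G`. -/
def L2.weightedPerm (A : G → H →L[ℂ] H) (K : ℝ) (hA : ∀ t, ‖A t‖ ≤ K) (σ : G ≃ G) :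
    L2 G H →L[ℂ] L2 G H :=
  have hp : 0 < (2 : ENNReal).toReal := by norm_num
  have hb : ∀ (ξ : L2 G H) (t : G), ‖A t (ξ (σ t))‖ ^ (2 : ENNReal).toReal ≤
      K ^ (2 : ENNReal).toReal * ‖ξ (σ t)‖ ^ (2 : ENNReal).toReal := fun ξ t => by
    have hK : 0 ≤ K := (norm_nonneg _).trans (hA t)
    rw [← Real.mul_rpow hK (norm_nonneg _)]
    exact Real.rpow_le_rpow (norm_nonneg _) ((A t).le_of_opNorm_le (hA t) _) hp.le
  have hs : ∀ ξ : L2 G H, Summable fun t => K ^ (2 : ENNReal).toReal *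
      ‖ξ (σ t)‖ ^ (2 : ENNReal).toReal := fun ξ =>
    ((σ.summable_iff (f := fun t => ‖ξ t‖ ^ (2 : ENNReal).toReal)).2
      ((lp.memℓp ξ).summable hp)).mul_left _
  have hs' : ∀ ξ : L2 G H, Summable fun t => ‖A t (ξ (σ t))‖ ^ (2 : ENNReal).toReal := fun ξ =>
    Summable.of_nonneg_of_le (fun _ => by positivity) (hb ξ) (hs ξ)
  LinearMap.mkContinuous
    { toFun := fun ξ => ⟨fun t => A t (ξ (σ t)), memℓp_gen (hs' ξ)⟩
      map_add' := fun ξ η => by ext t; exact map_add (A t) _ _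
      map_smul' := fun c ξ => by ext t; exact map_smul (A t) c _ }
    |K| fun ξ => by
      refine lp.norm_le_of_tsum_le hp (by positivity) ?_
      refine ((hs' ξ).tsum_le_tsum (hb ξ) (hs ξ)).trans ?_
      rw [tsum_mul_left, σ.tsum_eq (fun t => ‖ξ t‖ ^ (2 : ENNReal).toReal),
        ← lp.norm_rpow_eq_tsum hp, Real.mul_rpow (abs_nonneg _) (norm_nonneg _)]
      rw [abs_of_nonneg ((norm_nonneg _).trans (hA 1))]

@[simp]
theorem L2.weightedPerm_apply (A : G → H →L[ℂ] H) (K : ℝ) (hA : ∀ t, ‖A t‖ ≤ K) (σ : G ≃ G)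
    (ξ : L2 G H) (t : G) : L2.weightedPerm A K hA σ ξ t = A t (ξ (σ t)) := rfl

/-- The translation operator `(λ_s ξ)(t) = ξ (s⁻¹ t)` on `ℓ²(G, H)`. -/
def L2.translation (s : G) : L2 G H →L[ℂ] L2 G H :=
  L2.weightedPerm (fun _ => ContinuousLinearMap.id ℂ H) 1
    (fun _ => ContinuousLinearMap.norm_id_le) (Equiv.mulLeft s⁻¹)

@[simp]
theorem L2.translation_apply (s : G) (ξ : L2 G H) (t : G) :
    L2.translation s ξ t = ξ (s⁻¹ * t) := rfl

end Operators

namespace PartialAction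

variable {G X : Type*} [Group G] [TopologicalSpace X] (θ : PartialAction G X)
  {H : Type*} [NormedAddCommGroup H] [InnerProductSpace ℂ H] [CompleteSpace H]
  (π : C₀(X, ℂ) →⋆ₙₐ[ℂ] (H →L[ℂ] H))

/-- The representation `π̃` of `C₀(X)` on `ℓ²(G, H)` given by `(π̃(f) ξ)(t) = π_t(f) (ξ t)`. -/
def regRep : C₀(X, ℂ) →⋆ₙₐ[ℂ] (L2 G H →L[ℂ] L2 G H) where
  toFun f := L2.weightedPerm (fun t => θ.indRep π t f) ‖f‖ (fun t => θ.norm_indOp_le π t f)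
    (Equiv.refl G)
  map_smul' c f := by
    ext ξ t
    change θ.indRep π t (c • f) (ξ t) = c • θ.indRep π t f (ξ t)
    simp
  map_zero' := by
    ext ξ t
    change θ.indRep π t 0 (ξ t) = 0
    simp
  map_add' f g := by
    ext ξ t
    change θ.indRep π t (f + g) (ξ t) = θ.indRep π t f (ξ t) + θ.indRep π t g (ξ t)
    simp
  map_mul' f g := by
    ext ξ t
    change θ.indRep π t (f * g) (ξ t) = θ.indRep π t f (θ.indRep π t g (ξ t))
    simp
  map_star' f := by
    rw [ContinuousLinearMap.star_eq_adjoint, ContinuousLinearMap.eq_adjoint_iff]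
    intro ξ η
    rw [lp.inner_eq_tsum, lp.inner_eq_tsum]
    refine tsum_congr fun t => ?_
    change ⟪θ.indRep π t (star f) (ξ t), η t⟫_ℂ = ⟪ξ t, θ.indRep π t f (η t)⟫_ℂ
    rw [map_star, ContinuousLinearMap.star_eq_adjoint, ContinuousLinearMap.adjoint_inner_left]

@[simp]
theorem regRep_apply (f : C₀(X, ℂ)) (ξ : L2 G H) (t : G) :
    θ.regRep π f ξ t = θ.indRep π t f (ξ t) := rfl

/-- The operator by which `a δ_t` (for `a` in `D t`) acts in the regular representation of the
crossed product on `ℓ²(G, H)` that is induced by `π`, namely `π̃(a) λ_t`. -/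
def regOp (a : C₀(X, ℂ)) (t : G) : L2 G H →L[ℂ] L2 G H :=
  θ.regRep π a * L2.translation t

/-- The reduced crossed product `C₀(X) ⋊_r G`, realised on `ℓ²(G, H)` by the regular
representation induced by the representation `π` of `C₀(X)` (which is to be faithful): the
C*-algebra generated by the operators `a δ_t` with `t` in `G` and `a` in `D t`. -/
def reducedCrossedProduct : NonUnitalStarSubalgebra ℂ (L2 G H →L[ℂ] L2 G H) :=
  (NonUnitalStarAlgebra.adjoin ℂ
    {T | ∃ (t : G) (a : C₀(X, ℂ)), a ∈ θ.D t ∧ T = θ.regOp π a t}).topologicalClosure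

theorem regRep_mem (f : C₀(X, ℂ)) : θ.regRep π f ∈ θ.reducedCrossedProduct π := by
  refine NonUnitalStarSubalgebra.le_topologicalClosure _
    (NonUnitalStarAlgebra.subset_adjoin ℂ _ ⟨1, f, fun x hx => ?_, ?_⟩)
  · refine absurd ?_ hx
    have h := θ.source_eq 1
    rw [θ.map_one_source, inv_one] at h
    change x ∈ (θ.map 1).target
    rw [← h]
    exact mem_univ x
  · ext ξ t
    simp [regOp]

/-- The canonical copy of `C₀(X)` in `C₀(X) ⋊_r G`, by `f ↦ f δ_1`. -/
def incl : C₀(X, ℂ) →⋆ₙₐ[ℂ] θ.reducedCrossedProduct π :=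
  NonUnitalStarAlgHom.codRestrict (θ.regRep π) _ (θ.regRep_mem π)

end PartialAction

end

/-! Taking diagonal entries of operator matrices on `ℓ²(G, H)` gives a conditional expectation of
the crossed product onto `C₀(X)`: the entries of `T` are `π_r(f)` for a single function `f`
(`exists_diagonal`). It is faithful: if all diagonal entries of `T* T` vanish, then `T = 0`
(`L2.eq_zero_of_diag_star_mul_self`).

Let `T ≠ 0` lie in a closed ideal `I`. A multiple `b` of `T* T` lies in `I` and has diagonal part
`f` with `f x = 1` at some point. Approximate `b` by a finite sum `s` of operators `a δ_t`. Near
`x`, topological freeness gives a nonempty open set `W` that is displaced by each of the finitely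
many `t ≠ 1` in `s` (`TopologicallyFree.exists_open`). For a bump function `h` supported in `W`, the
compression `h s h` retains only the diagonal part of `s`, so `h b h` is at distance less than `1`
from `h²`. As `h b h` is in `I`, a geometric series argument
(`TwoSidedIdeal.mem_of_norm_sub_lt_one`) puts into `I` every `g` with `h² g = g`, and some such `g`
in `C₀(X)` is nonzero.

The statement on representations is the case where `I` is a kernel. -/

namespace PartialAction

/-! ### Points, functions and topological freeness. -/

section Space

variable {G X : Type*} [Group G] [TopologicalSpace X] (θ : PartialAction G X)

theorem source_map (t : G) : (θ.map t).source = θ.U t⁻¹ := θ.source_eq t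

theorem map_mem_U {t : G} {x : X} (hx : x ∈ θ.U t⁻¹) : θ.map t x ∈ θ.U t :=
  (θ.map t).map_source (by rwa [source_map])

theorem map_map {s t : G} {x : X} (hx : x ∈ θ.U t⁻¹) (hy : θ.map t x ∈ θ.U s⁻¹) :
    x ∈ θ.U (s * t)⁻¹ ∧ θ.map (s * t) x = θ.map s (θ.map t x) := by
  simp only [← source_map] at *
  exact θ.map_comp s t x hx hy

theorem map_inv_map {t : G} {x : X} (hx : x ∈ θ.U t⁻¹) : θ.map t⁻¹ (θ.map t x) = x := by
  have h := (θ.map_map (s := t⁻¹) hx (by simpa using θ.map_mem_U hx)).2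
  rw [← h, inv_mul_cancel, θ.map_one_apply]

theorem mem_U_one (x : X) : x ∈ θ.U 1 := by
  have h := θ.source_map 1
  rw [θ.map_one_source, inv_one] at h
  exact h ▸ mem_univ x

/-- `θ t` extends `θ (t * s) ∘ θ s⁻¹`, evaluated here at `θ s x`. -/
theorem map_of_map_mul {s t : G} {x : X} (hs : x ∈ θ.U s⁻¹) (hts : x ∈ θ.U (t * s)⁻¹) :
    θ.map s x ∈ θ.U t⁻¹ ∧ θ.map t (θ.map s x) = θ.map (t * s) x := by
  have h1 : θ.map s x ∈ θ.U s⁻¹⁻¹ := by simpa using θ.map_mem_U hs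
  have h := θ.map_map (s := t * s) (t := s⁻¹) h1 (by rwa [θ.map_inv_map hs])
  rw [θ.map_inv_map hs, mul_inv_cancel_right] at h
  exact h

/-- `θ s` extends `θ t⁻¹ ∘ θ (t * s)`. -/
theorem mem_U_of_map_mul {s t : G} {x : X} (hx : x ∈ θ.U (t * s)⁻¹)
    (ht : θ.map (t * s) x ∈ θ.U t) : x ∈ θ.U s⁻¹ := by
  have h := (θ.map_map (s := t⁻¹) hx (by simpa using ht)).1
  simpa using h

/-- The function `a ∘ θ t` on `U t⁻¹`, extended by `0`, for `a` in `D t`. -/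
noncomputable def pull [T2Space X] (t : G) (a : θ.D t) : C₀(X, ℂ) := by
  classical
  let g : X → ℂ := fun x => if x ∈ θ.U t⁻¹ then a.1 (θ.map t x) else 0
  -- This one estimate yields both vanishing at infinity and continuity at points outside `U t⁻¹`,
  -- since `K` is closed in the Hausdorff space `X`.
  have hK : ∀ ε > 0, ∃ K, IsCompact K ∧ K ⊆ θ.U t⁻¹ ∧ ∀ x ∉ K, ‖g x‖ < ε := by
    intro ε hε
    have h0 : ∀ᶠ x in Filter.cocompact X, ‖a.1 x‖ < ε :=
      (by simpa using a.1.zero_at_infty'.norm :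
        Filter.Tendsto (fun x => ‖a.1 x‖) (Filter.cocompact X) (𝓝 0)).eventually_lt_const hε
    obtain ⟨C, hC, hCs⟩ := Filter.mem_cocompact.1 h0
    have hcl : IsClosed {x | ε ≤ ‖a.1 x‖} :=
      isClosed_le continuous_const (map_continuous a.1).norm
    have hsub : {x | ε ≤ ‖a.1 x‖} ⊆ C := fun x hx => by
      by_contra hxC
      have h1 := hCs hxC
      simp only [mem_ofPred_eq] at h1 hx
      exact absurd h1 (not_lt.2 hx)
    have hcomp : IsCompact {x | ε ≤ ‖a.1 x‖} := hC.of_isClosed_subset hcl hsub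
    have hU : {x | ε ≤ ‖a.1 x‖} ⊆ θ.U t := fun x hx => by
      by_contra hxU
      rw [mem_ofPred_eq, a.2 x hxU, norm_zero] at hx
      exact absurd hx (not_le.2 hε)
    refine ⟨(θ.map t).symm '' {x | ε ≤ ‖a.1 x‖},
      hcomp.image_of_continuousOn ((θ.map t).continuousOn_symm.mono hU), ?_, ?_⟩
    · rintro _ ⟨x, hx, rfl⟩
      rw [← source_map]
      exact (θ.map t).map_target (hU hx)
    · intro x hx
      by_cases hxU : x ∈ θ.U t⁻¹
      · simp only [g, if_pos hxU]
        by_contra hlt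
        refine hx ⟨θ.map t x, not_lt.1 hlt, (θ.map t).left_inv ?_⟩
        rwa [source_map]
      · simpa [g, if_neg hxU] using hε
  exact
  { toFun := g
    continuous_toFun := by
      rw [continuous_iff_continuousAt]
      intro x
      by_cases hx : x ∈ θ.U t⁻¹
      · have h1 : ContinuousAt (fun x => a.1 (θ.map t x)) x :=
          ((map_continuous a.1).comp_continuousOn (θ.continuousOn_map t)).continuousAt
            ((θ.isOpen_U t⁻¹).mem_nhds hx)
        refine h1.congr ?_
        filter_upwards [(θ.isOpen_U t⁻¹).mem_nhds hx] with y hy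
        simp [g, hy]
      · have hgx : g x = 0 := if_neg hx
        rw [ContinuousAt, hgx, tendsto_zero_iff_norm_tendsto_zero, Metric.tendsto_nhds]
        intro ε hε
        obtain ⟨K, hKc, hKU, hKg⟩ := hK ε hε
        filter_upwards [hKc.isClosed.isOpen_compl.mem_nhds fun h => hx (hKU h)] with y hy
        simpa using hKg y hy
    zero_at_infty' := by
      rw [tendsto_zero_iff_norm_tendsto_zero, Metric.tendsto_nhds]
      intro ε hε
      obtain ⟨K, hKc, -, hKg⟩ := hK ε hε
      filter_upwards [hKc.compl_mem_cocompact] with y hy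
      simpa using hKg y hy }

theorem pull_apply_of_mem [T2Space X] {t : G} (a : θ.D t) {x : X} (hx : x ∈ θ.U t⁻¹) :
    θ.pull t a x = a.1 (θ.map t x) := by
  simp only [pull]
  exact if_pos hx

theorem pull_mem [T2Space X] (t : G) (a : θ.D t) : θ.pull t a ∈ θ.D t⁻¹ := fun x hx => by
  simp only [pull]
  exact if_neg hx

variable {θ} in
/-- For a topologically free partial action, every nonempty open set contains a nonempty open set
that is displaced by finitely many given `θ t` with `t ≠ 1`. -/
theorem TopologicallyFree.exists_open [T2Space X] (hθ : θ.TopologicallyFree) (F : Finset G)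
    (hF : 1 ∉ F) {V : Set X} (hV : IsOpen V) (hne : V.Nonempty) :
    ∃ W ⊆ V, IsOpen W ∧ W.Nonempty ∧ ∀ t ∈ F, ∀ x ∈ W, x ∈ θ.U t⁻¹ → θ.map t x ∉ W := by
  classical
  induction F using Finset.induction_on with
  | empty => exact ⟨V, Subset.rfl, hV, hne, by simp⟩
  | insert t F _ ih =>
    rw [Finset.mem_insert, not_or] at hF
    obtain ⟨W, hWV, hW, hWne, hWF⟩ := ih hF.2
    by_cases hemp : (W ∩ θ.U t⁻¹).Nonempty
    · have hopen : IsOpen (W ∩ θ.U t⁻¹) := hW.inter (θ.isOpen_U _)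
      -- Otherwise `θ t` would fix a nonempty open set pointwise.
      obtain ⟨x, hx, hxt⟩ : ∃ x ∈ W ∩ θ.U t⁻¹, θ.map t x ≠ x := by
        by_contra! hall
        have : W ∩ θ.U t⁻¹ ⊆ interior (θ.fixedPts t) :=
          interior_maximal (fun x hx => ⟨hx.2, hall x hx⟩) hopen
        rw [hθ t (Ne.symm hF.1)] at this
        exact hemp.ne_empty (subset_empty_iff.1 this)
      obtain ⟨A, B, hA, hB, hxA, hxB, hAB⟩ := t2_separation hxt
      have ho : IsOpen (θ.U t⁻¹ ∩ θ.map t ⁻¹' A) :=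
        (θ.continuousOn_map t).isOpen_inter_preimage (θ.isOpen_U _) hA
      -- Points of the new set lie in `B` and are sent by `θ t` into `A`, which is disjoint from
      -- `B`.
      refine ⟨W ∩ B ∩ (θ.U t⁻¹ ∩ θ.map t ⁻¹' A), fun y hy => hWV hy.1.1, (hW.inter hB).inter ho,
        ⟨x, ⟨hx.1, hxB⟩, hx.2, hxA⟩, fun r hr y hy hyr hy' => ?_⟩
      rcases Finset.mem_insert.1 hr with rfl | hr
      · exact disjoint_left.1 hAB hy.2.2 hy'.1.2
      · exact hWF r hr y hy.1.1 hyr hy'.1.1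
    · refine ⟨W, hWV, hW, hWne, fun r hr y hy hyr => ?_⟩
      rcases Finset.mem_insert.1 hr with rfl | hr
      · exact absurd ⟨y, hy, hyr⟩ hemp
      · exact hWF r hr y hy hyr

end Space

/-! ### Covariance of the representations `π_t`; products and adjoints of the operators `a δ_t`. -/

section Induced

variable {G X : Type*} [Group G] [TopologicalSpace X] (θ : PartialAction G X)
  {H : Type*} [NormedAddCommGroup H] [InnerProductSpace ℂ H] [CompleteSpace H]
  (π : C₀(X, ℂ) →⋆ₙₐ[ℂ] (H →L[ℂ] H))

theorem indRep_apply (t : G) (f : C₀(X, ℂ)) (b : θ.D t⁻¹) (h : H) :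
    θ.indRep π t f (π b.1 h) = π (θ.pullMul t f b) h := θ.indOp_apply π t f b h

theorem indRep_orthogonal (t : G) (f : C₀(X, ℂ)) {v : H} (hv : v ∈ (θ.essSpace π t)ᗮ) :
    θ.indRep π t f v = 0 := θ.indOp_orthogonal π t f hv

theorem inner_indRep (t : G) (f : C₀(X, ℂ)) (v w : H) :
    ⟪θ.indRep π t f v, w⟫_ℂ = ⟪v, θ.indRep π t (star f) w⟫_ℂ := by
  rw [map_star, ContinuousLinearMap.star_eq_adjoint, ContinuousLinearMap.adjoint_inner_right]

/-- Two vectors agree if they have the same inner products with `π(D t⁻¹) H` and with its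
orthogonal complement. -/
theorem vec_ext (t : G) {v w : H}
    (h₁ : ∀ (b : θ.D t⁻¹) (h : H), ⟪v, π b.1 h⟫_ℂ = ⟪w, π b.1 h⟫_ℂ)
    (h₂ : ∀ u ∈ (θ.essSpace π t)ᗮ, ⟪v, u⟫_ℂ = ⟪w, u⟫_ℂ) : v = w := by
  have : innerSL ℂ v = innerSL ℂ w := θ.clm_ext π t h₁ h₂
  exact ext_inner_right ℂ fun u => congrArg (fun A : H →L[ℂ] ℂ => A u) this

/-- Extends the defining formula of `π_s(f)` to `b` outside `D s⁻¹`. Both sides are orthogonal to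
the complement of `π(D s⁻¹) H`, and against `π(D s⁻¹) H` only the values on `U s⁻¹` count. -/
theorem indRep_apply_of_eq (s : G) {f b k : C₀(X, ℂ)}
    (hk : ∀ x ∈ θ.U s⁻¹, k x = f (θ.map s x) * b x) (hk' : k ∈ θ.D s⁻¹) (h : H) :
    θ.indRep π s f (π b h) = π k h := by
  refine θ.vec_ext π s (fun b' h' => ?_) fun u hu => ?_
  · rw [inner_indRep, indRep_apply, inner_apply_apply, inner_apply_apply]
    congr 3
    ext x
    by_cases hx : x ∈ θ.U s⁻¹
    · simp [hk x hx]
      ring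
    · simp [b'.2 x hx]
  · rw [inner_indRep, θ.indRep_orthogonal π s _ hu, inner_zero_right]
    exact ((Submodule.mem_orthogonal _ u).1 hu _ (θ.mem_essSpace π ⟨k, hk'⟩ h)).symm

/-- The covariance relation `π_{ts}(a) = π_s(α_{t⁻¹}(a))` behind all later computations with `a
δ_t`. -/
theorem indRep_mul_eq [T2Space X] (t s : G) (a : θ.D t) :
    θ.indRep π (t * s) a.1 = θ.indRep π s (θ.pull t a) := by
  refine θ.clm_ext π (t * s) (fun b h => ?_) fun w hw => ?_
  · rw [indRep_apply]
    symm
    refine θ.indRep_apply_of_eq π s (fun x hx => ?_) (fun x hx => ?_) h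
    · rw [pullMul_apply]
      by_cases hts : x ∈ θ.U (t * s)⁻¹
      · obtain ⟨h1, h2⟩ := θ.map_of_map_mul hx hts
        rw [θ.pull_apply_of_mem a h1, h2]
      · rw [b.2 x hts, mul_zero, mul_zero]
    · rw [pullMul_apply]
      by_cases hts : x ∈ θ.U (t * s)⁻¹
      · rw [a.2 _ fun ht => hx (θ.mem_U_of_map_mul hts ht), zero_mul]
      · rw [b.2 x hts, mul_zero]
  · rw [θ.indRep_orthogonal π _ _ hw]
    refine θ.vec_ext π s (fun b h => ?_) fun u hu => ?_
    · rw [inner_indRep, indRep_apply, inner_zero_left]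
      -- The product is supported on the points `x` for which `θ t (θ s x)` is defined, and these
      -- lie in `U (t * s)⁻¹`; so `w` is orthogonal to its range.
      suffices hmem : θ.pullMul s (star (θ.pull t a)) b ∈ θ.D (t * s)⁻¹ from
        ((Submodule.mem_orthogonal' _ w).1 hw _ (θ.mem_essSpace π ⟨_, hmem⟩ h)).symm
      intro x hx
      rw [pullMul_apply]
      by_cases hs : x ∈ θ.U s⁻¹
      · have : θ.map s x ∉ θ.U t⁻¹ := fun ht => hx (θ.map_map hs ht).1
        rw [ZeroAtInftyContinuousMap.star_apply, θ.pull_mem t a _ this, star_zero, zero_mul]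
      · rw [b.2 x hs, mul_zero]
    · rw [inner_indRep, θ.indRep_orthogonal π s _ hu, inner_zero_right, inner_zero_left]

/-- Since `U 1 = X`, the complement of `π(D 1) H` is orthogonal to the range of every `π(f*)`, hence
is killed by `π(f)`. -/
theorem indRep_one (f : C₀(X, ℂ)) : θ.indRep π 1 f = π f := by
  refine θ.clm_ext π 1 (fun b h => ?_) fun w hw => ?_
  · rw [indRep_apply, ← mul_apply_eq_comp, ← map_mul]
    congr 2
    ext x
    simp [θ.map_one_apply]
  · rw [θ.indRep_orthogonal π _ _ hw]
    refine ext_inner_right ℂ fun u => ?_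
    rw [inner_zero_left, ← ContinuousLinearMap.adjoint_inner_right,
      ← ContinuousLinearMap.star_eq_adjoint, ← map_star]
    exact ((Submodule.mem_orthogonal' _ w).1 hw _ (θ.mem_essSpace π
      ⟨star f, fun x hx => absurd (by rw [inv_one]; exact θ.mem_U_one x) hx⟩ u)).symm

theorem regOp_apply (a : C₀(X, ℂ)) (t : G) (ξ : L2 G H) (r : G) :
    θ.regOp π a t ξ r = θ.indRep π r a (ξ (t⁻¹ * r)) := rfl

theorem regOp_one (a : C₀(X, ℂ)) : θ.regOp π a 1 = θ.regRep π a := by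
  ext ξ r
  simp [regOp_apply]

/-- The product is `(a δ_t)(b δ_s) = α_t(α_{t⁻¹}(a) b) δ_{ts}`; at `x` in `U t` its coefficient is
`b (θ t⁻¹ x) * a x`. -/
theorem regOp_mul_regOp [T2Space X] {t s : G} (a : θ.D t) (b : θ.D s) :
    ∃ c ∈ θ.D (t * s), θ.regOp π a.1 t * θ.regOp π b.1 s = θ.regOp π c (t * s) := by
  have ha : a.1 ∈ θ.D t⁻¹⁻¹ := by simp
  set c := θ.pullMul t⁻¹ b.1 ⟨a.1, ha⟩ with hc
  have hct : c ∈ θ.D t := fun x hx => by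
    rw [hc, pullMul_apply]
    simp only [a.2 x hx, mul_zero]
  refine ⟨c, fun x hx => ?_, ?_⟩
  · by_cases hxt : x ∈ θ.U t
    · have h1 : θ.map t⁻¹ x ∉ θ.U s := fun h2 => hx <| by
        have := (θ.map_map (s := s⁻¹) (t := t⁻¹) (x := x) (by simpa using hxt)
          (by simpa using h2)).1
        simpa using this
      rw [hc, pullMul_apply, b.2 _ h1, zero_mul]
    · exact hct x hxt
  · have hpull : θ.pull t ⟨c, hct⟩ = θ.pull t a * b.1 := by
      ext x
      by_cases hx : x ∈ θ.U t⁻¹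
      · have h1 : c (θ.map t x) = b.1 x * a.1 (θ.map t x) := by
          rw [hc, pullMul_apply, θ.map_inv_map hx]
        rw [θ.pull_apply_of_mem _ hx, ZeroAtInftyContinuousMap.mul_apply,
          θ.pull_apply_of_mem _ hx, h1, mul_comm]
      · rw [ZeroAtInftyContinuousMap.mul_apply, θ.pull_mem t _ x hx, θ.pull_mem t _ x hx, zero_mul]
    ext ξ r
    obtain ⟨q, rfl⟩ : ∃ q, r = t * q := ⟨t⁻¹ * r, by simp⟩
    change θ.indRep π (t * q) a.1 (θ.indRep π (t⁻¹ * (t * q)) b.1 (ξ (s⁻¹ * (t⁻¹ * (t * q))))) =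
      θ.indRep π (t * q) c (ξ ((t * s)⁻¹ * (t * q)))
    rw [θ.indRep_mul_eq π t q a, θ.indRep_mul_eq π t q ⟨c, hct⟩, hpull, map_mul,
      mul_apply_eq_comp, mul_inv_rev, mul_assoc, inv_mul_cancel_left]

/-- The adjoint is `α_{t⁻¹}(a*) δ_{t⁻¹}`, by covariance and the substitution `r ↦ t r` in the inner
product. -/
theorem star_regOp [T2Space X] {t : G} (a : θ.D t) :
    ∃ c ∈ θ.D t⁻¹, star (θ.regOp π a.1 t) = θ.regOp π c t⁻¹ := by
  let a' : θ.D t := ⟨star a.1, fun x hx => by simp [a.2 x hx]⟩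
  refine ⟨θ.pull t a', θ.pull_mem t a', ?_⟩
  rw [eq_comm, ContinuousLinearMap.star_eq_adjoint, ContinuousLinearMap.eq_adjoint_iff]
  intro ξ η
  rw [lp.inner_eq_tsum, lp.inner_eq_tsum]
  refine Eq.trans (tsum_congr fun r => ?_)
    ((Equiv.mulLeft t).tsum_eq fun r => ⟪ξ r, θ.regOp π a.1 t η r⟫_ℂ)
  rw [regOp_apply, regOp_apply, Equiv.coe_mulLeft, ← θ.indRep_mul_eq, inner_indRep, star_star,
    inv_inv, inv_mul_cancel_left]

end Induced
end PartialAction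

/-! ### Diagonals of operators on `ℓ²(G, H)`. -/

section Diagonal

variable {G H : Type*} [NormedAddCommGroup H] [InnerProductSpace ℂ H]

open Classical in
/-- The diagonal entry at `r` of the operator matrix of `T`. -/
noncomputable def L2.diag (r : G) : (L2 G H →L[ℂ] L2 G H) →ₗ[ℂ] (H →L[ℂ] H) where
  toFun T := (lp.evalCLM ℂ (fun _ : G => H) 2 r).comp
    (T.comp (lp.singleContinuousLinearMap ℂ (fun _ : G => H) 2 r))
  map_add' S T := by ext; simp
  map_smul' c T := by ext; simp

open Classical in
theorem L2.diag_apply (r : G) (T : L2 G H →L[ℂ] L2 G H) (v : H) :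
    L2.diag r T v = T (lp.single 2 r v) r := rfl

theorem L2.norm_diag_le (r : G) (T : L2 G H →L[ℂ] L2 G H) : ‖L2.diag r T‖ ≤ ‖T‖ := by
  classical
  refine ContinuousLinearMap.opNorm_le_bound _ T.opNorm_nonneg fun v => ?_
  rw [L2.diag_apply]
  refine (lp.norm_apply_le_norm two_ne_zero _ r).trans ((T.le_opNorm _).trans_eq ?_)
  rw [lp.norm_single (by norm_num)]

/-- The entry of `T* T` at `r` computes `‖T ξ‖²` for `ξ` supported at `r`, and such `ξ` span a dense
subspace. -/
theorem L2.eq_zero_of_diag_star_mul_self [CompleteSpace H] {T : L2 G H →L[ℂ] L2 G H}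
    (h : ∀ r, L2.diag r (star T * T) = 0) : T = 0 := by
  classical
  have hs : ∀ r v, T (lp.single 2 r v) = 0 := fun r v => by
    have h1 : ⟪lp.single 2 r v, (star T * T) (lp.single 2 r v)⟫_ℂ = 0 := by
      rw [lp.inner_single_left, ← L2.diag_apply, h r]
      simp
    rwa [mul_apply_eq_comp, ContinuousLinearMap.star_eq_adjoint,
      ContinuousLinearMap.adjoint_inner_right, inner_self_eq_zero] at h1
  ext1 ξ
  have h2 := (lp.hasSum_single (p := 2) (by norm_num) ξ).mapL T
  simp only [hs] at h2
  exact h2.unique hasSum_zero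

end Diagonal

/-! ### The conditional expectation onto `C₀(X)`. -/

namespace PartialAction

variable {G X : Type*} [Group G] [TopologicalSpace X] (θ : PartialAction G X)
  {H : Type*} [NormedAddCommGroup H] [InnerProductSpace ℂ H] [CompleteSpace H]
  (π : C₀(X, ℂ) →⋆ₙₐ[ℂ] (H →L[ℂ] H))

theorem diag_regRep (r : G) (f : C₀(X, ℂ)) : L2.diag r (θ.regRep π f) = θ.indRep π r f := by
  ext v
  simp [L2.diag_apply]

theorem diag_regOp_of_ne_one (r : G) (a : C₀(X, ℂ)) {t : G} (ht : t ≠ 1) :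
    L2.diag r (θ.regOp π a t) = 0 := by
  classical
  ext v
  rw [L2.diag_apply, regOp_apply, lp.single_apply_ne _ _ _ (by simpa using ht), map_zero]
  rfl

/-- By covariance the coefficient, pulled back by `θ t`, is a multiple of `h (θ t x) * h x`. -/
theorem regRep_mul_regOp_mul_regRep [T2Space X] {t : G} (a : θ.D t) {h : C₀(X, ℂ)}
    (hh : ∀ x ∈ θ.U t⁻¹, h x * h (θ.map t x) = 0) :
    θ.regRep π h * θ.regOp π a.1 t * θ.regRep π h = 0 := by
  have hmem : h * a.1 ∈ θ.D t := fun x hx => by simp [a.2 x hx]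
  have h0 : θ.pull t ⟨h * a.1, hmem⟩ * h = 0 := by
    ext x
    rw [ZeroAtInftyContinuousMap.mul_apply, ZeroAtInftyContinuousMap.zero_apply]
    by_cases hx : x ∈ θ.U t⁻¹
    · rw [θ.pull_apply_of_mem _ hx, ZeroAtInftyContinuousMap.mul_apply, mul_right_comm,
        mul_comm (h _), hh x hx, zero_mul]
    · rw [θ.pull_mem t _ x hx, zero_mul]
  ext ξ r
  obtain ⟨q, rfl⟩ : ∃ q, r = t * q := ⟨t⁻¹ * r, by simp⟩
  change θ.indRep π (t * q) h (θ.indRep π (t * q) a.1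
    (θ.indRep π (t⁻¹ * (t * q)) h (ξ (t⁻¹ * (t * q))))) = 0
  rw [inv_mul_cancel_left, ← mul_apply_eq_comp, ← map_mul, θ.indRep_mul_eq π t q ⟨_, hmem⟩,
    ← mul_apply_eq_comp, ← map_mul, h0, map_zero]
  rfl

/-- The generators are closed under products and adjoints, so their linear span is already a
*-algebra. -/
theorem adjoin_le_span [T2Space X] {T : L2 G H →L[ℂ] L2 G H}
    (hT : T ∈ NonUnitalStarAlgebra.adjoin ℂ
      {T | ∃ (t : G) (a : C₀(X, ℂ)), a ∈ θ.D t ∧ T = θ.regOp π a t}) :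
    T ∈ Submodule.span ℂ {T | ∃ (t : G) (a : C₀(X, ℂ)), a ∈ θ.D t ∧ T = θ.regOp π a t} := by
  induction hT using NonUnitalStarAlgebra.adjoin_induction with
  | mem x hx => exact Submodule.subset_span hx
  | add x y _ _ hx hy => exact add_mem hx hy
  | zero => exact zero_mem _
  | smul c x _ hx => exact Submodule.smul_mem _ c hx
  | mul x y _ _ hx hy =>
    have := Submodule.mul_mem_mul hx hy
    rw [Submodule.span_mul_span] at this
    refine Submodule.span_mono ?_ this
    rintro _ ⟨_, ⟨t, a, ha, rfl⟩, _, ⟨s, b, hb, rfl⟩, rfl⟩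
    obtain ⟨c, hc, h⟩ := θ.regOp_mul_regOp π ⟨a, ha⟩ ⟨b, hb⟩
    exact ⟨t * s, c, hc, h⟩
  | star x _ hx =>
    clear * - hx
    induction hx using Submodule.span_induction with
    | mem x hx =>
      obtain ⟨t, a, ha, rfl⟩ := hx
      obtain ⟨c, hc, h⟩ := θ.star_regOp π ⟨a, ha⟩
      exact Submodule.subset_span ⟨t⁻¹, c, hc, h⟩
    | zero => simp
    | add x y _ _ hx hy => rw [star_add]; exact add_mem hx hy
    | smul c x _ hx => rw [star_smul]; exact Submodule.smul_mem _ _ hx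

/-- A finite sum `s` of operators `a δ_t` has a diagonal part in `C₀(X)`, to which it is cut down
by any `h` whose support is displaced by the other `t` that occur in `s`. -/
theorem exists_diagonal_of_mem_span [T2Space X] {s : L2 G H →L[ℂ] L2 G H}
    (hs : s ∈ Submodule.span ℂ
      {T | ∃ (t : G) (a : C₀(X, ℂ)), a ∈ θ.D t ∧ T = θ.regOp π a t}) :
    ∃ a : C₀(X, ℂ), (∀ r, L2.diag r s = θ.indRep π r a) ∧ ∃ F : Finset G, 1 ∉ F ∧
      ∀ h : C₀(X, ℂ), (∀ t ∈ F, ∀ x ∈ θ.U t⁻¹, h x * h (θ.map t x) = 0) →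
        θ.regRep π h * s * θ.regRep π h = θ.regRep π (h * a * h) := by
  classical
  induction hs using Submodule.span_induction with
  | mem s hs =>
    obtain ⟨t, a, ha, rfl⟩ := hs
    by_cases ht : t = 1
    · subst ht
      refine ⟨a, fun r => by rw [regOp_one, diag_regRep], ∅, by simp, fun h _ => ?_⟩
      rw [regOp_one, map_mul, map_mul]
    · refine ⟨0, fun r => by rw [θ.diag_regOp_of_ne_one π r a ht, map_zero], {t},
        by simpa using Ne.symm ht, fun h hh => ?_⟩
      rw [θ.regRep_mul_regOp_mul_regRep π ⟨a, ha⟩ (hh t (Finset.mem_singleton_self t)),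
        mul_zero, zero_mul, map_zero]
  | zero => exact ⟨0, by simp, ∅, by simp, by simp⟩
  | add x y _ _ hx hy =>
    obtain ⟨a, ha, F, hF, hFa⟩ := hx
    obtain ⟨b, hb, F', hF', hFb⟩ := hy
    refine ⟨a + b, fun r => by rw [map_add, map_add, ha, hb], F ∪ F', by simp [hF, hF'],
      fun h hh => ?_⟩
    rw [mul_add, add_mul, hFa h fun t ht => hh t (Finset.mem_union_left _ ht),
      hFb h fun t ht => hh t (Finset.mem_union_right _ ht), ← map_add, mul_add, add_mul]
  | smul c x _ hx =>
    obtain ⟨a, ha, F, hF, hFa⟩ := hx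
    refine ⟨c • a, fun r => by rw [map_smul, map_smul, ha], F, hF, fun h hh => ?_⟩
    rw [mul_smul_comm, smul_mul_assoc, hFa h hh, ← map_smul, mul_smul_comm, smul_mul_assoc]

theorem exists_span_near [T2Space X] {T : L2 G H →L[ℂ] L2 G H}
    (hT : T ∈ θ.reducedCrossedProduct π) {ε : ℝ} (hε : 0 < ε) :
    ∃ s ∈ Submodule.span ℂ {T | ∃ (t : G) (a : C₀(X, ℂ)), a ∈ θ.D t ∧ T = θ.regOp π a t},
      ‖T - s‖ < ε := by
  obtain ⟨s, hs, h⟩ := Metric.mem_closure_iff.1 hT ε hε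
  exact ⟨s, θ.adjoin_le_span π hs, by rwa [← dist_eq_norm]⟩

theorem norm_regRep_le (f : C₀(X, ℂ)) : ‖θ.regRep π f‖ ≤ ‖f‖ :=
  NonUnitalStarAlgHom.norm_apply_le _ f

/-- The conditional expectation onto `C₀(X)`. -/
theorem exists_diagonal [T2Space X] (hπ : Function.Injective π) {T : L2 G H →L[ℂ] L2 G H}
    (hT : T ∈ θ.reducedCrossedProduct π) :
    ∃ a : C₀(X, ℂ), ∀ r, L2.diag r T = θ.indRep π r a := by
  have hiso := NonUnitalStarAlgHom.isometry π hπ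
  have hcl : IsClosed (range π) := hiso.isClosedEmbedding.isClosed_range
  -- At `r = 1` the representation `π_1` is `π`, whose range is closed because an injective
  -- *-homomorphism is isometric. So the entry at `1` determines `f`.
  have h1 : L2.diag 1 T ∈ closure (range π) := by
    refine Metric.mem_closure_iff.2 fun ε hε => ?_
    obtain ⟨s, hs, hTs⟩ := θ.exists_span_near π hT hε
    obtain ⟨a, ha, -⟩ := θ.exists_diagonal_of_mem_span π hs
    refine ⟨π a, mem_range_self a, ?_⟩
    rw [← θ.indRep_one, ← ha, dist_eq_norm, ← map_sub]
    exact (L2.norm_diag_le _ _).trans_lt hTs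
  rw [hcl.closure_eq] at h1
  obtain ⟨f, hf⟩ := h1
  refine ⟨f, fun r => eq_of_forall_dist_le fun ε hε => ?_⟩
  obtain ⟨s, hs, hTs⟩ := θ.exists_span_near π hT (half_pos hε)
  obtain ⟨a, ha, -⟩ := θ.exists_diagonal_of_mem_span π hs
  -- The entry at `1` controls `a - f` in norm, and hence, as each `π_r` is contractive, all other
  -- entries.
  have hfa : ‖a - f‖ ≤ ‖T - s‖ := by
    rw [← NonUnitalStarAlgHom.norm_map π hπ, map_sub, hf, ← θ.indRep_one, ← ha, norm_sub_rev,
      ← map_sub]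
    exact L2.norm_diag_le _ _
  calc dist (L2.diag r T) (θ.indRep π r f)
      ≤ dist (L2.diag r T) (L2.diag r s) + dist (L2.diag r s) (θ.indRep π r f) :=
        dist_triangle _ _ _
    _ ≤ ε / 2 + ε / 2 := by
        gcongr
        · rw [dist_eq_norm, ← map_sub]
          exact (L2.norm_diag_le _ _).trans hTs.le
        · rw [ha, dist_eq_norm, ← map_sub]
          exact (NonUnitalStarAlgHom.norm_apply_le _ _).trans (hfa.trans hTs.le)
    _ = ε := add_halves ε

end PartialAction

/-! ### Bump functions, and a geometric series in closed ideals. -/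

/-- If `V` is an open neighbourhood of `x` in a locally compact Hausdorff space, then some `h` in
`C₀(X)` that is bounded by `1` vanishes off `V` and is `1` near `x`. -/
theorem exists_zeroAtInfty_bump {X : Type*} [TopologicalSpace X] [T2Space X]
    [LocallyCompactSpace X] {V : Set X} (hV : IsOpen V) {x : X} (hx : x ∈ V) :
    ∃ h : C₀(X, ℂ), (∀ y, ‖h y‖ ≤ 1) ∧ (∀ y ∉ V, h y = 0) ∧ ∃ W, IsOpen W ∧ x ∈ W ∧
      ∀ y ∈ W, h y = 1 := by
  obtain ⟨K, hK, hxK, hKV⟩ := exists_compact_subset hV hx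
  obtain ⟨f, hf1, hf0, hfc, hf⟩ := exists_continuous_one_zero_of_isCompact hK hV.isClosed_compl
    (disjoint_compl_right_iff_subset.2 hKV)
  have hg : HasCompactSupport fun y => (f y : ℂ) := hfc.comp_left (g := Complex.ofReal) rfl
  refine ⟨⟨⟨fun y => (f y : ℂ), by fun_prop⟩, hg.is_zero_at_infty⟩, fun y => ?_, fun y hy => ?_,
    interior K, isOpen_interior, hxK, fun y hy => ?_⟩
  · change ‖(f y : ℂ)‖ ≤ 1
    rw [Complex.norm_real, Real.norm_of_nonneg (hf y).1]
    exact (hf y).2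
  · change (f y : ℂ) = 0
    simp [hf0 hy]
  · change (f y : ℂ) = 1
    simp [hf1 (interior_subset hy)]

/-- A closed two-sided ideal that contains some `i` with `‖f - i‖ < 1` contains every `g` with
`f * g = g`. -/
theorem TwoSidedIdeal.mem_of_norm_sub_lt_one {A : Type*} [NonUnitalNormedRing A]
    {I : TwoSidedIdeal A} (hI : IsClosed (I : Set A)) {f g i : A} (hi : i ∈ I)
    (hfi : ‖f - i‖ < 1) (hfg : f * g = g) : g ∈ I := by
  -- This is `(f - i)ⁿ g`, which tends to `0` and is congruent to `g` modulo `I` because `f g = g`.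
  let v : ℕ → A := fun n => (fun y => (f - i) * y)^[n] g
  have hv : ∀ n, v (n + 1) = (f - i) * v n := fun n => Function.iterate_succ_apply' _ _ _
  have hmem : ∀ n, g - v n ∈ I := by
    intro n
    induction n with
    | zero => simp [v, I.zero_mem]
    | succ n ih =>
      have : g - v (n + 1) = i * g + (f - i) * (g - v n) := by
        rw [hv, mul_sub, sub_mul f i g, hfg]
        abel
      rw [this]
      exact I.add_mem (I.mul_mem_right _ _ hi) (I.mul_mem_left _ _ ih)
  have hnorm : ∀ n, ‖v n‖ ≤ ‖f - i‖ ^ n * ‖g‖ := by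
    intro n
    induction n with
    | zero => simp [v]
    | succ n ih =>
      rw [hv, pow_succ', mul_assoc]
      exact (norm_mul_le _ _).trans (mul_le_mul_of_nonneg_left ih (norm_nonneg _))
  have hlim : Filter.Tendsto v Filter.atTop (𝓝 0) := by
    refine squeeze_zero_norm hnorm ?_
    simpa using (tendsto_pow_atTop_nhds_zero_of_lt_one (norm_nonneg _) hfi).mul_const ‖g‖
  have hlim' : Filter.Tendsto (fun n => g - v n) Filter.atTop (𝓝 g) := by
    simpa using hlim.const_sub g
  exact hI.mem_of_tendsto hlim' (Filter.Eventually.of_forall hmem)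

/-! ### The ideal intersection property. -/

namespace PartialAction

variable {G X : Type*} [Group G] [TopologicalSpace X] (θ : PartialAction G X)
  {H : Type*} [NormedAddCommGroup H] [InnerProductSpace ℂ H] [CompleteSpace H]
  (π : C₀(X, ℂ) →⋆ₙₐ[ℂ] (H →L[ℂ] H))

theorem incl_injective (hπ : Function.Injective π) : Function.Injective (θ.incl π) := by
  intro f g hfg
  have h : θ.regRep π f = θ.regRep π g := congrArg Subtype.val hfg
  have h1 := congrArg (L2.diag 1) h
  rw [diag_regRep, diag_regRep, indRep_one, indRep_one] at h1
  exact hπ h1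

variable {θ} in
/-- For a topologically free partial action, an element `b` of the crossed product whose diagonal
part is close to `1` on a nonempty open set can be cut down to an element close to `C₀(X)`. -/
theorem TopologicallyFree.exists_norm_regRep_sub_lt [T2Space X] [LocallyCompactSpace X]
    (hθ : θ.TopologicallyFree) (hπ : Function.Injective π) {b : L2 G H →L[ℂ] L2 G H}
    (hb : b ∈ θ.reducedCrossedProduct π) {f : C₀(X, ℂ)}
    (hf : ∀ r, L2.diag r b = θ.indRep π r f) {x : X} (hx : f x = 1) :
    ∃ h g : C₀(X, ℂ), g ≠ 0 ∧ h * h * g = g ∧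
      ‖θ.regRep π (h * h) - θ.regRep π h * b * θ.regRep π h‖ < 1 := by
  -- Three errors of at most `1 / 4` arise: from `b` against `s`, from `f` against `a`, and from `f`
  -- against `1` on `W`. Their sum is below `1`.
  obtain ⟨s, hs, hbs⟩ := θ.exists_span_near π hb (ε := 1 / 4) (by norm_num)
  obtain ⟨a, ha, F, hF, hFa⟩ := θ.exists_diagonal_of_mem_span π hs
  have hfa : ‖f - a‖ < 1 / 4 := by
    rw [← NonUnitalStarAlgHom.norm_map π hπ, map_sub, ← θ.indRep_one π f, ← θ.indRep_one π a, ← ha, ← hf,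
      ← map_sub]
    exact (L2.norm_diag_le _ _).trans_lt hbs
  have hVo : IsOpen {y | ‖1 - f y‖ < 1 / 4} :=
    isOpen_lt (continuous_const.sub (map_continuous f)).norm continuous_const
  obtain ⟨W, hWV, hW, ⟨w, hw⟩, hWF⟩ := hθ.exists_open F hF hVo ⟨x, by simp [hx]⟩
  obtain ⟨h, hh1, hh0, W', hW', hwW', hhW'⟩ := exists_zeroAtInfty_bump hW hw
  -- `g` is supported where `h = 1`, which forces `h * h * g = g`.
  obtain ⟨g, -, hg0, W'', -, hwW'', hgW''⟩ := exists_zeroAtInfty_bump hW' hwW'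
  refine ⟨h, g, fun h0 => ?_, ?_, ?_⟩
  · have := hgW'' w hwW''
    simp [h0] at this
  · ext y
    by_cases hy : y ∈ W'
    · simp [hhW' y hy]
    · simp [hg0 y hy]
  · have hcut : θ.regRep π h * s * θ.regRep π h = θ.regRep π (h * a * h) := hFa h fun t ht y hy => by
      by_cases hyW : y ∈ W
      · rw [hh0 _ (hWF t ht y hyW hy), mul_zero]
      · rw [hh0 y hyW, zero_mul]
    have hh : ‖h‖ ≤ 1 := by
      rw [← ZeroAtInftyContinuousMap.norm_toBCF_eq_norm]
      exact (BoundedContinuousFunction.norm_le zero_le_one).2 hh1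
    have hR : ‖θ.regRep π h‖ ≤ 1 := (θ.norm_regRep_le π h).trans hh
    have h1 : ‖h * h - h * f * h‖ ≤ 1 / 4 := by
      rw [← ZeroAtInftyContinuousMap.norm_toBCF_eq_norm]
      refine (BoundedContinuousFunction.norm_le (by norm_num)).2 fun y => ?_
      change ‖h y * h y - h y * f y * h y‖ ≤ 1 / 4
      by_cases hyW : y ∈ W
      · have h2 : ‖1 - f y‖ < 1 / 4 := hWV hyW
        have h3 : h y * h y - h y * f y * h y = h y * (1 - f y) * h y := by ring
        rw [h3, norm_mul, norm_mul]
        calc ‖h y‖ * ‖1 - f y‖ * ‖h y‖ ≤ 1 * (1 / 4) * 1 := by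
              gcongr <;> exact hh1 y
          _ = 1 / 4 := by norm_num
      · rw [hh0 y hyW]
        norm_num
    have h2 : ‖h * (f - a) * h‖ ≤ 1 / 4 := by
      calc ‖h * (f - a) * h‖ ≤ ‖h‖ * ‖f - a‖ * ‖h‖ :=
            (norm_mul_le _ _).trans (mul_le_mul_of_nonneg_right (norm_mul_le _ _) (norm_nonneg _))
        _ ≤ 1 * (1 / 4) * 1 := by gcongr
        _ = 1 / 4 := by norm_num
    have h3 : ‖θ.regRep π h * (b - s) * θ.regRep π h‖ ≤ 1 / 4 := by
      calc _ ≤ ‖θ.regRep π h‖ * ‖b - s‖ * ‖θ.regRep π h‖ :=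
            (norm_mul_le _ _).trans (mul_le_mul_of_nonneg_right (norm_mul_le _ _) (norm_nonneg _))
        _ ≤ 1 * (1 / 4) * 1 := by gcongr
        _ = 1 / 4 := by norm_num
    have hsplit : θ.regRep π (h * h) - θ.regRep π h * b * θ.regRep π h =
        θ.regRep π (h * h - h * f * h) + θ.regRep π (h * (f - a) * h) -
          θ.regRep π h * (b - s) * θ.regRep π h := by
      rw [mul_sub _ b s, sub_mul _ _ (θ.regRep π h), hcut, ← map_add, mul_sub, sub_mul,
        sub_add_sub_cancel, map_sub]
      abel
    rw [hsplit]
    refine (norm_sub_le _ _).trans_lt ?_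
    have h4 := norm_add_le (θ.regRep π (h * h - h * f * h)) (θ.regRep π (h * (f - a) * h))
    have h5 := (θ.norm_regRep_le π (h * h - h * f * h)).trans h1
    have h6 := (θ.norm_regRep_le π (h * (f - a) * h)).trans h2
    linarith

variable {θ} in
/-- The ideal intersection property of topologically free partial actions. -/
theorem TopologicallyFree.eq_bot_of_inter_eq_zero [T2Space X] [LocallyCompactSpace X]
    (hθ : θ.TopologicallyFree) (hπ : Function.Injective π)
    (I : TwoSidedIdeal (θ.reducedCrossedProduct π))
    (hI : IsClosed (I : Set (θ.reducedCrossedProduct π)))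
    (h0 : ∀ f, θ.incl π f ∈ I → f = 0) : I = ⊥ := by
  rw [eq_bot_iff]
  intro T hT
  rw [TwoSidedIdeal.mem_bot]
  by_contra hT0
  obtain ⟨f, hf⟩ := θ.exists_diagonal π hπ (star T * T).2
  have hf0 : f ≠ 0 := by
    rintro rfl
    refine hT0 (Subtype.ext (L2.eq_zero_of_diag_star_mul_self fun r => ?_))
    exact (hf r).trans (map_zero _)
  obtain ⟨x, hx⟩ : ∃ x, f x ≠ 0 := by
    by_contra! hall
    exact hf0 (ZeroAtInftyContinuousMap.ext hall)
  -- Dividing by `f x` makes the diagonal part `1` at `x`; positivity of `f` plays no role.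
  have hbI : ((f x)⁻¹ • star T) * T ∈ I := I.mul_mem_left _ _ hT
  have hbf : ∀ r, L2.diag r (((f x)⁻¹ • star T) * T : θ.reducedCrossedProduct π).1 =
      θ.indRep π r ((f x)⁻¹ • f) := fun r => by
    rw [smul_mul_assoc, map_smul, ← hf r, ← map_smul]
    rfl
  obtain ⟨h, g, hg0, hhg, hlt⟩ := hθ.exists_norm_regRep_sub_lt π hπ (Subtype.prop _) hbf
    (x := x) (by simp [hx])
  refine hg0 (h0 g (I.mem_of_norm_sub_lt_one hI (f := θ.incl π (h * h))
    (i := θ.incl π h * (((f x)⁻¹ • star T) * T) * θ.incl π h)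
    (I.mul_mem_right _ _ (I.mul_mem_left _ _ hbI)) hlt ?_))
  rw [← map_mul, hhg]

end PartialAction

theorem mainTheorem1 {G X H : Type*} [Group G]
    [TopologicalSpace X] [T2Space X] [LocallyCompactSpace X]
    [NormedAddCommGroup H] [InnerProductSpace ℂ H] [CompleteSpace H]
    (θ : PartialAction G X) (hθ : θ.TopologicallyFree)
    (π : C₀(X, ℂ) →⋆ₙₐ[ℂ] (H →L[ℂ] H)) (hπ : Function.Injective π) :
    (∀ I : TwoSidedIdeal (θ.reducedCrossedProduct π),
      IsClosed (I : Set (θ.reducedCrossedProduct π)) →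
      (I : Set (θ.reducedCrossedProduct π)) ∩ Set.range (θ.incl π) = {0} →
      I = ⊥) ∧
    (∀ {K : Type*} [NormedAddCommGroup K] [InnerProductSpace ℂ K] [CompleteSpace K]
      (ρ : θ.reducedCrossedProduct π →⋆ₙₐ[ℂ] (K →L[ℂ] K)),
      Function.Injective ρ ↔ Function.Injective fun f : C₀(X, ℂ) => ρ (θ.incl π f)) := by
  refine ⟨fun I hI h0 => hθ.eq_bot_of_inter_eq_zero π hπ I hI fun f hf => ?_, fun ρ =>
    ⟨fun hρ => hρ.comp (θ.incl_injective π hπ), fun hρ => ?_⟩⟩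
  · have : θ.incl π f ∈ (I : Set (θ.reducedCrossedProduct π)) ∩ Set.range (θ.incl π) :=
      ⟨hf, mem_range_self f⟩
    rw [h0, mem_singleton_iff] at this
    exact θ.incl_injective π hπ (this.trans (map_zero _).symm)
  · have : IsClosed (θ.reducedCrossedProduct π : Set (L2 G H →L[ℂ] L2 G H)) :=
      NonUnitalStarSubalgebra.isClosed_topologicalClosure _
    have hρc : Continuous ρ := AddMonoidHomClass.continuous_of_bound ρ 1 fun y => by
      simpa using NonUnitalStarAlgHom.norm_apply_le ρ y
    rw [← TwoSidedIdeal.ker_eq_bot]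
    refine hθ.eq_bot_of_inter_eq_zero π hπ _ ?_ fun f hf => ?_
    · have : (TwoSidedIdeal.ker ρ : Set (θ.reducedCrossedProduct π)) = ρ ⁻¹' {0} := by
        ext y
        exact TwoSidedIdeal.mem_ker ρ
      rw [this]
      exact isClosed_singleton.preimage hρc
    · rw [TwoSidedIdeal.mem_ker] at hf
      exact hρ (by simpa using hf)
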